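/- Let $F$ be a finite field. For an integer $k\ge 1$, a balanced factorisation of $a\in F$ into $k$ factors is a representation $a=a_1a_2\cdots a_k$ with $a_1,\dots,a_k\in F$ and $a_1+a_2+\cdots+a_k=0$ (the factors need not be distinct). (i) Let $k\ge 2$ be an integer. Then every element of $F$ admits a balanced factorisation into $k$ factors if and only if one of the following holds: - $|F|=2$ and $k$ is even; - $|F|=4$ and $k\ne 3$; - $|F|$ is a power of two other than $2$ and $4$ (and $k$ is arbitrary); - $|F|\in\{3,5\}$ and $k\notin\{2,4\}$; - $|F|=7$ and $k\notin\{2,3\}$; - $|F|$ is neither a power of two nor $3$, $5$ or $7$, and $k\ne 2$. (ii) In particular, $F$ contains an element having no balanced factorisation into at most three factors (that is, into $k$ factors for any $k\in\{1,2,3\}$) if and only if $|F|=7$. -/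

import Mathlib

/-- `a = a₁ a₂ ⋯ aₖ` is a factorisation of `a` into `k` factors (listed in order) which is
balanced, i.e. `a₁ + a₂ + ⋯ + aₖ = 0`. -/
structure IsBalancedFactorisation {R : Type*} [Ring R] (k : ℕ) (a : R) (l : List R) : Prop where
  length_eq : l.length = k
  prod_eq : l.prod = a
  sum_eq_zero : l.sum = 0

/-- `a` admits a balanced factorisation into a product of `k` factors. -/
def HasBalancedFactorisation {R : Type*} [Ring R] (k : ℕ) (a : R) : Prop :=
  ∃ l : List R, IsBalancedFactorisation k a l

/-! ### The cubic equation `x * y * (x + y) = a` -/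

section Cubic

variable {F : Type*} [Field F]

/-! Prepending `1, -1` to a balanced factorisation of `-a` gives one of `a`, so if length `k`
reaches all of `F`, so does `k + 2`. It remains to find the least universal length of each parity.
Length 2 reaches the elements `-x ^ 2`, hence everything exactly in characteristic two. Length 3
amounts to `x * y * (x + y) = -a`; putting `y = t * x`, one needs `t * (1 + t)` to hit a prescribed
class modulo cubes, which Jacobi sums of a cubic character ensure for `q > 7`, where `q = |F|`.
Length 4, for odd `q ≥ 7`, reduces to making `2 * r * (r ^ 2 + a)` a nonzero square, obtained from a
second moment of quadratic character sums. Fields too small for these bounds are settled by hand. -/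

lemma exists_mul_mul_add_eq_of_cube {a c t : F} (ht : t * (1 + t) ≠ 0)
    (hc : c ^ 3 = t * (1 + t) / a) (ha : a ≠ 0) : ∃ x y : F, x * y * (x + y) = a := by
  have hc0 : c ≠ 0 := by
    rintro rfl
    have : t * (1 + t) / a ≠ 0 := div_ne_zero ht ha
    simp at hc
    tauto
  refine ⟨c⁻¹, t * c⁻¹, ?_⟩
  have : a * c ^ 3 = t * (1 + t) := by rw [hc]; field_simp
  field_simp
  linear_combination -this

variable [Fintype F]

lemma MulChar.norm_jacobiSum_sq {χ φ : MulChar F ℂ} (hχ : χ ≠ 1) (hφ : φ ≠ 1)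
    (hχφ : χ * φ ≠ 1) : ‖jacobiSum χ φ‖ ^ 2 = Fintype.card F := by
  have hchar : ringChar ℂ ≠ ringChar F := by
    rw [ringChar.eq_zero]
    exact (CharP.ringChar_ne_zero_of_finite F).symm
  have hconj : jacobiSum χ⁻¹ φ⁻¹ = (starRingEnd ℂ) (jacobiSum χ φ) := by
    simp only [jacobiSum, map_sum, map_mul]
    refine Finset.sum_congr rfl fun x _ ↦ ?_
    rw [← MulChar.star_apply', ← MulChar.star_apply']
    rfl
  have h := jacobiSum_mul_jacobiSum_inv hchar hχ hφ hχφ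
  rw [hconj, Complex.mul_conj, Complex.normSq_eq_norm_sq] at h
  exact_mod_cast h

lemma MulChar.sum_mul_one_add (χ : MulChar F ℂ) :
    ∑ t : F, χ (t * (1 + t)) = χ (-1) * jacobiSum χ χ := by
  rw [← Equiv.sum_comp (Equiv.neg F), jacobiSum, Finset.mul_sum]
  refine Finset.sum_congr rfl fun t _ ↦ ?_
  rw [Equiv.neg_apply, ← map_mul, ← map_mul]
  congr 1
  ring

/-- A character of order three detects cubes. -/
lemma MulChar.exists_pow_three_eq {χ : MulChar F ℂ} (hχ : orderOf χ = 3) {u : F}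
    (hu : u ≠ 0) (h1 : χ u = 1) : ∃ c : F, c ^ 3 = u := by
  obtain ⟨g, hg⟩ := IsCyclic.exists_generator (α := Fˣ)
  obtain ⟨m, hm⟩ := Subgroup.mem_zpowers_iff.mp (hg (Units.mk0 u hu))
  -- Triviality at the generator `g` would make `χ` trivial. So `χ g` has order exactly 3, and `χ (g
  -- ^ m) = 1` forces `3 ∣ m`.
  have hne : χ g ≠ 1 := by
    intro h
    have : χ = 1 := by
      ext x
      obtain ⟨n, rfl⟩ := Subgroup.mem_zpowers_iff.mp (hg x)
      rw [MulChar.one_apply_coe, ← MulChar.coe_equivToUnitHom, map_zpow]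
      have : MulChar.equivToUnitHom χ g = 1 := by
        ext
        rw [MulChar.coe_equivToUnitHom, h]
        rfl
      simp [this]
    rw [this, orderOf_one] at hχ
    omega
  have h3 : MulChar.equivToUnitHom χ g ^ 3 = 1 := by
    ext
    rw [Units.val_pow_eq_pow_val, MulChar.coe_equivToUnitHom, ← MulChar.pow_apply_coe, ← hχ,
      pow_orderOf_eq_one, MulChar.one_apply_coe]
    rfl
  have hord : orderOf (MulChar.equivToUnitHom χ g) = 3 := by
    refine orderOf_eq_prime h3 fun h ↦ hne ?_
    rw [← MulChar.coe_equivToUnitHom, h]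
    rfl
  have hz : MulChar.equivToUnitHom χ g ^ m = 1 := by
    ext
    rw [← map_zpow, hm, MulChar.coe_equivToUnitHom, Units.val_mk0, h1]
    rfl
  obtain ⟨n, rfl⟩ : (3 : ℤ) ∣ m := by
    have := orderOf_dvd_iff_zpow_eq_one.mpr hz
    rwa [hord] at this
  refine ⟨((g ^ n : Fˣ) : F), ?_⟩
  rw [← Units.val_pow_eq_pow_val, ← zpow_natCast, ← zpow_mul, mul_comm n]
  exact congrArg Units.val hm

lemma exists_mul_one_add_ne_zero (hq : 2 < Fintype.card F) : ∃ t : F, t * (1 + t) ≠ 0 := by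
  classical
  obtain ⟨t, ht⟩ : ∃ t, t ∉ ({0, -1} : Finset F) := by
    by_contra! h
    have := Finset.card_le_card (fun x _ ↦ h x : (Finset.univ : Finset F) ⊆ {0, -1})
    have h2 := Finset.card_le_two (a := (0 : F)) (b := -1)
    rw [Finset.card_univ] at this
    omega
  simp only [Finset.mem_insert, Finset.mem_singleton, not_or] at ht
  refine ⟨t, mul_ne_zero ht.1 fun h ↦ ht.2 ?_⟩
  linear_combination h

/-- Cubing is a bijection of `Fˣ` here, so any `t` other than `0, -1` serves. -/
lemma exists_mul_mul_add_eq_of_not_dvd (hq : 2 < Fintype.card F)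
    (h3 : ¬ 3 ∣ Fintype.card F - 1) {a : F} (ha : a ≠ 0) :
    ∃ x y : F, x * y * (x + y) = a := by
  obtain ⟨t, ht⟩ := exists_mul_one_add_ne_zero hq
  have hcop : (Nat.card Fˣ).Coprime 3 := by
    rw [Nat.card_units, Nat.card_eq_fintype_card]
    exact ((Nat.Prime.coprime_iff_not_dvd Nat.prime_three).mpr h3).symm
  obtain ⟨c, hc⟩ := (powCoprime hcop).surjective (Units.mk0 _ (div_ne_zero ht ha))
  refine exists_mul_mul_add_eq_of_cube (c := (c : F)) ht ?_ ha
  simpa using congrArg Units.val hc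

/-- If no `u = t * (1 + t) / a` is a nonzero cube, then `1 + χ u + χ u ^ 2 = 0` whenever `u ≠ 0`.
Summing over `t` writes `q - 2` as minus two Jacobi sum terms, each of norm at most `√q`. -/
lemma exists_mul_mul_add_eq_of_dvd (hq : 7 < Fintype.card F)
    (h3 : 3 ∣ Fintype.card F - 1) {a : F} (ha : a ≠ 0) :
    ∃ x y : F, x * y * (x + y) = a := by
  classical
  obtain ⟨χ, hχ⟩ := MulChar.exists_mulChar_orderOf F h3
    (Complex.isPrimitiveRoot_exp 3 (by norm_num))
  by_contra hno
  have hχ1 : χ ≠ 1 := by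
    rintro rfl
    rw [orderOf_one] at hχ
    omega
  have hχ3 : χ ^ 3 = 1 := by rw [← hχ, pow_orderOf_eq_one]
  have hχ2 : χ ^ 2 ≠ 1 := by
    intro h
    have := orderOf_dvd_of_pow_eq_one h
    rw [hχ] at this
    omega
  have hterm (t : F) : (if t * (1 + t) = 0 then (0 : ℂ) else 1)
      + (χ a⁻¹ * χ (t * (1 + t)) + (χ ^ 2) a⁻¹ * (χ ^ 2) (t * (1 + t))) = 0 := by
    split_ifs with h
    · simp [h, MulChar.map_zero]
    · have hu : t * (1 + t) / a ≠ 0 := div_ne_zero h ha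
      have hne : χ (t * (1 + t) / a) ≠ 1 := fun h1 ↦ by
        obtain ⟨c, hc⟩ := MulChar.exists_pow_three_eq hχ hu h1
        exact hno (exists_mul_mul_add_eq_of_cube h hc ha)
      have hcube : χ (t * (1 + t) / a) ^ 3 = 1 := by
        rw [← MulChar.pow_apply' _ (by norm_num), hχ3, MulChar.one_apply hu.isUnit]
      rw [← map_mul, ← map_mul, MulChar.pow_apply' _ (by norm_num), mul_comm a⁻¹,
        ← div_eq_mul_inv]
      refine (mul_eq_zero.mp ?_).resolve_left (sub_ne_zero.mpr hne)
      linear_combination hcube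
  have hsum := Finset.sum_eq_zero fun t (_ : t ∈ Finset.univ) ↦ hterm t
  rw [Finset.sum_add_distrib, Finset.sum_add_distrib, ← Finset.mul_sum, ← Finset.mul_sum,
    MulChar.sum_mul_one_add, MulChar.sum_mul_one_add] at hsum
  have hcount : ∑ t : F, (if t * (1 + t) = 0 then (0 : ℂ) else 1) = Fintype.card F - 2 := by
    have hset : (Finset.univ.filter fun t : F ↦ t * (1 + t) = 0) = {0, -1} := by
      ext t
      simp [add_eq_zero_iff_eq_neg']
    have := Finset.card_filter_add_card_filter_not (s := (Finset.univ : Finset F))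
      (fun t : F ↦ t * (1 + t) = 0)
    rw [hset, Finset.card_pair (by simp), Finset.card_univ] at this
    rw [← this]
    simp [Finset.sum_ite]
  have hnorm (ψ : MulChar F ℂ) (x : F) : ‖ψ x‖ ≤ 1 := by
    by_cases hx : x = 0
    · simp [hx, MulChar.map_zero]
    · have h : ψ x ^ (Fintype.card F - 1) = 1 := by
        rw [← map_pow, FiniteField.pow_card_sub_one_eq_one x hx, map_one]
      exact (Complex.norm_eq_one_of_pow_eq_one h (by omega)).le
  have hJ (ψ : MulChar F ℂ) (h1 : ψ ≠ 1) (h2 : ψ * ψ ≠ 1) :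
      ‖ψ a⁻¹ * (ψ (-1) * jacobiSum ψ ψ)‖ ≤ √(Fintype.card F) := by
    rw [norm_mul, norm_mul]
    have hJ : ‖jacobiSum ψ ψ‖ = √(Fintype.card F) := by
      rw [← MulChar.norm_jacobiSum_sq h1 h1 h2, Real.sqrt_sq (norm_nonneg _)]
    rw [hJ]
    have := hnorm ψ (-1)
    have := hnorm ψ a⁻¹
    calc _ ≤ 1 * (1 * √(Fintype.card F : ℝ)) := by gcongr
      _ = _ := by ring
  have hb1 := hJ χ hχ1 (by rwa [← sq])
  have hb2 := hJ (χ ^ 2) hχ2 (by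
    rw [← pow_add, pow_succ, hχ3, one_mul]
    exact hχ1)
  have hle : ((Fintype.card F : ℝ) - 2) ≤ 2 * √(Fintype.card F) := by
    calc ((Fintype.card F : ℝ) - 2) ≤ ‖((Fintype.card F : ℂ) - 2)‖ := by
          have := Complex.re_le_norm ((Fintype.card F : ℂ) - 2)
          simpa using this
      _ = ‖χ a⁻¹ * (χ (-1) * jacobiSum χ χ)
            + (χ ^ 2) a⁻¹ * ((χ ^ 2) (-1) * jacobiSum (χ ^ 2) (χ ^ 2))‖ := by
          rw [← hcount, ← norm_neg]
          congr 1
          linear_combination -hsum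
      _ ≤ _ := (norm_add_le _ _).trans (by linarith)
  have hs := Real.sq_sqrt (Nat.cast_nonneg (α := ℝ) (Fintype.card F))
  have h8 : (8 : ℝ) ≤ Fintype.card F := by exact_mod_cast hq
  -- `q - 2 ≤ 2 * √q` fails from `q = 8` on, but holds at the genuine exception `q = 7`.
  nlinarith [Real.sqrt_nonneg (Fintype.card F : ℝ)]

end Cubic

/-! ### Values of `2 * r * (r ^ 2 + a)` -/

section Quadratic

open Finset

variable {F : Type*} [Field F] [Fintype F] [DecidableEq F]

lemma quadraticChar_sum_add_mul_add (hF : ringChar F ≠ 2) (u v : F) :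
    ∑ a : F, quadraticChar F (u + a) * quadraticChar F (v + a) =
      (if u = v then (Fintype.card F : ℤ) else 0) - 1 := by
  split_ifs with h
  · subst h
    rw [← Equiv.sum_comp (Equiv.subRight u)]
    simp only [Equiv.subRight_apply, add_sub_cancel]
    have (x : F) : quadraticChar F x * quadraticChar F x = 1 - if x = 0 then 1 else 0 := by
      split_ifs with hx
      · simp [hx]
      · rw [← sq, quadraticChar_sq_one hx, sub_zero]
    simp only [this, sum_sub_distrib, sum_ite_eq', mem_univ, if_true, sum_const, card_univ,
      nsmul_eq_mul, mul_one]
  · have huv : u - v ≠ 0 := sub_ne_zero.mpr h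
    -- Substituting `a = (u - v) * x - u` turns the correlation into a Jacobi sum of the character
    -- with its inverse.
    rw [← Equiv.sum_comp ((Equiv.mulLeft₀ _ huv).trans (Equiv.subRight u))]
    have hinv : (quadraticChar F)⁻¹ = quadraticChar F := (quadraticChar_isQuadratic F).inv
    have hJ := jacobiSum_nontrivial_inv (quadraticChar_ne_one hF)
    rw [hinv, jacobiSum] at hJ
    have hterm (x : F) : quadraticChar F (u + ((Equiv.mulLeft₀ _ huv).trans (Equiv.subRight u)) x)
        * quadraticChar F (v + ((Equiv.mulLeft₀ _ huv).trans (Equiv.subRight u)) x) =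
        quadraticChar F (-1) * (quadraticChar F x * quadraticChar F (1 - x)) := by
      have h1 : u + ((Equiv.mulLeft₀ _ huv).trans (Equiv.subRight u)) x = (u - v) * x := by
        simp
      have h2 : v + ((Equiv.mulLeft₀ _ huv).trans (Equiv.subRight u)) x =
          (u - v) * (-1 * (1 - x)) := by
        simp
        ring
      rw [h1, h2]
      simp only [map_mul]
      linear_combination (quadraticChar F (-1) * quadraticChar F x * quadraticChar F (1 - x)) *
        quadraticChar_sq_one huv
    rw [sum_congr rfl fun x _ ↦ hterm x, ← mul_sum, hJ]
    linear_combination -quadraticChar_sq_one (neg_ne_zero.mpr (one_ne_zero (α := F)))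

/-- Expand the square and sum over `a` first: the correlation is `q * [r ^ 2 = s ^ 2] - 1`. The `-1`
contributes nothing because the character sums to zero, and each `r` has at most two partners `s = ±
r`. -/
lemma quadraticChar_second_moment_le (hF : ringChar F ≠ 2) :
    ∑ a : F, (∑ r : F, quadraticChar F r * quadraticChar F (r ^ 2 + a)) ^ 2 ≤
      2 * (Fintype.card F : ℤ) ^ 2 := by
  have hle (x : F) : |quadraticChar F x| ≤ 1 := by
    by_cases hx : x = 0
    · simp [hx]
    · rcases quadraticChar_dichotomy hx with h | h <;> simp [h]
  have hinner (r : F) : ∑ s : F, quadraticChar F r * quadraticChar F s *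
      (if r ^ 2 = s ^ 2 then (Fintype.card F : ℤ) else 0) ≤ 2 * Fintype.card F := by
    have hcard : #{s : F | r ^ 2 = s ^ 2} ≤ 2 := by
      refine (card_le_card fun s hs ↦ ?_).trans (card_le_two (a := r) (b := -r))
      simp only [mem_filter, mem_univ, true_and] at hs
      rcases sq_eq_sq_iff_eq_or_eq_neg.mp hs.symm with h | h <;> simp [h]
    calc _ ≤ ∑ s : F, if r ^ 2 = s ^ 2 then (Fintype.card F : ℤ) else 0 := by
          refine sum_le_sum fun s _ ↦ ?_
          have : quadraticChar F r * quadraticChar F s ≤ 1 := by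
            rw [← map_mul]
            exact (le_abs_self _).trans (hle _)
          split_ifs <;> nlinarith
      _ = #{s : F | r ^ 2 = s ^ 2} * (Fintype.card F : ℤ) := by
          rw [← sum_filter, sum_const, nsmul_eq_mul]
      _ ≤ _ := by gcongr; exact_mod_cast hcard
  calc _ = ∑ r : F, ∑ s : F, quadraticChar F r * quadraticChar F s *
        ∑ a : F, quadraticChar F (r ^ 2 + a) * quadraticChar F (s ^ 2 + a) := by
        simp only [sq (∑ r : F, _), sum_mul_sum]
        simp only [mul_sum]
        rw [sum_comm]
        refine sum_congr rfl fun r _ ↦ ?_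
        rw [sum_comm]
        refine sum_congr rfl fun s _ ↦ sum_congr rfl fun a _ ↦ ?_
        ring
    _ = (∑ r : F, ∑ s : F, quadraticChar F r * quadraticChar F s *
          (if r ^ 2 = s ^ 2 then (Fintype.card F : ℤ) else 0))
        - (∑ r : F, quadraticChar F r) * ∑ s : F, quadraticChar F s := by
        rw [sum_mul_sum, ← sum_sub_distrib]
        refine sum_congr rfl fun r _ ↦ ?_
        rw [← sum_sub_distrib]
        refine sum_congr rfl fun s _ ↦ ?_
        rw [quadraticChar_sum_add_mul_add hF]
        ring
    _ ≤ ∑ r : F, 2 * (Fintype.card F : ℤ) := by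
        rw [quadraticChar_sum_zero hF, zero_mul, sub_zero]
        exact sum_le_sum fun r _ ↦ hinner r
    _ = _ := by
        rw [sum_const, nsmul_eq_mul, card_univ]
        ring

/-- The class of `2 * r * (r ^ 2 + a)` is not always that of nonsquares. -/
lemma exists_isSquare_two_mul_mul_sq_add (hF : ringChar F ≠ 2) (hq : 7 ≤ Fintype.card F) {a : F}
    (ha : ¬ IsSquare a) :
    ∃ r w : F, r ≠ 0 ∧ w ≠ 0 ∧ 2 * r * (r ^ 2 + a) = w ^ 2 := by
  have h20 : (2 : F) ≠ 0 := Ring.two_ne_zero hF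
  have ha0 : a ≠ 0 := fun h ↦ ha (h ▸ IsSquare.zero)
  have hχa := quadraticChar_neg_one_iff_not_isSquare.mpr ha
  suffices h : ∃ r : F, r ≠ 0 ∧ r ^ 2 + a ≠ 0 ∧ quadraticChar F (2 * r * (r ^ 2 + a)) = 1 by
    obtain ⟨r, hr, hra, h1⟩ := h
    have hne : 2 * r * (r ^ 2 + a) ≠ 0 := mul_ne_zero (mul_ne_zero h20 hr) hra
    obtain ⟨w, hw⟩ := (quadraticChar_one_iff_isSquare hne).mp h1
    refine ⟨r, w, hr, ?_, by rw [hw, sq]⟩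
    rintro rfl
    exact hne (by simpa using hw)
  -- When `-1` is a nonsquare, replacing `r` by `-r` flips the class. Otherwise, if only nonsquares
  -- occurred, the sum at `a`, and by scaling at every nonsquare `a * g ^ 2`, would be `± (q - 1)`,
  -- too large for the second moment.
  by_cases hneg : quadraticChar F (-1) = -1
  · obtain ⟨r, hr, hra⟩ : ∃ r : F, r ≠ 0 ∧ r ^ 2 + a ≠ 0 := by
      by_contra! h
      have hsub : (univ : Finset F) ⊆ {0, 1, -1} := by
        intro r _
        by_cases hr : r = 0
        · simp [hr]
        · have h1 := h r hr
          have h2 := h 1 one_ne_zero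
          have : r ^ 2 = 1 ^ 2 := by linear_combination h1 - h2
          rcases sq_eq_sq_iff_eq_or_eq_neg.mp this with h | h <;> simp [h]
      have := (card_le_card hsub).trans card_le_three
      rw [card_univ] at this
      omega
    rcases quadraticChar_dichotomy (mul_ne_zero (mul_ne_zero h20 hr) hra) with h | h
    · exact ⟨r, hr, hra, h⟩
    · refine ⟨-r, neg_ne_zero.mpr hr, by simpa using hra, ?_⟩
      rw [show 2 * -r * ((-r) ^ 2 + a) = -1 * (2 * r * (r ^ 2 + a)) by ring, map_mul, h, hneg]
      norm_num
  · have hneg1 : quadraticChar F (-1) = 1 :=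
      (quadraticChar_dichotomy (neg_ne_zero.mpr one_ne_zero)).resolve_right hneg
    by_contra! hno
    have hra (r : F) : r ^ 2 + a ≠ 0 := by
      intro h
      have : a = -1 * r ^ 2 := by linear_combination h
      by_cases hr : r = 0
      · exact ha0 (by simpa [hr] using this)
      · rw [this, map_mul, hneg1, quadraticChar_sq_one' hr] at hχa
        norm_num at hχa
    have hconst (r : F) (hr : r ≠ 0) :
        quadraticChar F r * quadraticChar F (r ^ 2 + a) = -quadraticChar F 2 := by
      have h := (quadraticChar_dichotomy (mul_ne_zero (mul_ne_zero h20 hr) (hra r))).resolve_left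
        (hno r hr (hra r))
      rw [map_mul, map_mul] at h
      linear_combination quadraticChar F 2 * h -
        (quadraticChar F r * quadraticChar F (r ^ 2 + a)) * quadraticChar_sq_one h20
    have hTa : ∑ r : F, quadraticChar F r * quadraticChar F (r ^ 2 + a) =
        -quadraticChar F 2 * (Fintype.card F - 1) := by
      have (r : F) : quadraticChar F r * quadraticChar F (r ^ 2 + a) =
          -quadraticChar F 2 * (1 - if r = 0 then 1 else 0) := by
        split_ifs with hr
        · simp [hr]
        · rw [hconst r hr, sub_zero, mul_one]
      rw [sum_congr rfl fun r _ ↦ this r, ← mul_sum]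
      simp
    have hT (g : F) (hg : g ≠ 0) :
        (∑ r : F, quadraticChar F r * quadraticChar F (r ^ 2 + a * g ^ 2)) ^ 2 =
          (Fintype.card F - 1) ^ 2 := by
      have : ∑ r : F, quadraticChar F r * quadraticChar F (r ^ 2 + a * g ^ 2) =
          quadraticChar F g * ∑ r : F, quadraticChar F r * quadraticChar F (r ^ 2 + a) := by
        rw [← Equiv.sum_comp (Equiv.mulLeft₀ g hg), mul_sum]
        refine sum_congr rfl fun r _ ↦ ?_
        rw [Equiv.mulLeft₀_apply, show (g * r) ^ 2 + a * g ^ 2 = g ^ 2 * (r ^ 2 + a) by ring,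
          map_mul, map_mul, quadraticChar_sq_one' hg]
        ring
      rw [this, hTa, mul_pow, mul_pow, neg_sq, quadraticChar_sq_one hg, quadraticChar_sq_one h20]
      ring
    -- The weight is 2 at nonsquares and 0 elsewhere.
    have hpt (b : F) : (1 - quadraticChar F b - if b = 0 then 1 else 0) *
        ((Fintype.card F : ℤ) - 1) ^ 2 ≤
        2 * (∑ r : F, quadraticChar F r * quadraticChar F (r ^ 2 + b)) ^ 2 := by
      by_cases hb : b = 0
      · simp only [hb, MulChar.map_zero]
        simp
        positivity
      rcases quadraticChar_dichotomy hb with h | h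
      · rw [h, if_neg hb]
        simp only [sub_self, zero_mul]
        positivity
      · have hsq : IsSquare (b / a) := by
          rw [← quadraticChar_one_iff_isSquare (div_ne_zero hb ha0)]
          have : quadraticChar F (b / a) * quadraticChar F a = quadraticChar F b := by
            rw [← map_mul, div_mul_cancel₀ _ ha0]
          rw [hχa, h] at this
          linarith
        obtain ⟨g, hg⟩ := hsq
        have hbg : b = a * g ^ 2 := by
          rw [sq, ← hg]
          field_simp
        have hg0 : g ≠ 0 := by
          rintro rfl
          simp at hbg
          exact hb hbg
        rw [h, if_neg hb, hbg, hT g hg0]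
        linarith
    have hsum := sum_le_sum fun b (_ : b ∈ univ) ↦ hpt b
    rw [← mul_sum, ← sum_mul, sum_sub_distrib, sum_sub_distrib, quadraticChar_sum_zero hF] at hsum
    have hM := quadraticChar_second_moment_le hF
    simp only [sum_const, card_univ, nsmul_eq_mul, mul_one, sum_ite_eq', mem_univ, if_true,
      sub_zero] at hsum
    have hq' : (7 : ℤ) ≤ Fintype.card F := by exact_mod_cast hq
    generalize (Fintype.card F : ℤ) = q at *
    have : (q - 1) * (q - 1) ^ 2 ≤ 4 * q ^ 2 := by linarith
    -- `(q - 1) ^ 3 ≤ 4 * q ^ 2` already fails at `q = 7`.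
    nlinarith [mul_nonneg (sub_nonneg.mpr hq') (sub_nonneg.mpr hq')]

end Quadratic

/-! ### Balanced factorisations -/

section Balanced

lemma HasBalancedFactorisation.zero {R : Type*} [Ring R] {k : ℕ} (hk : k ≠ 0) :
    HasBalancedFactorisation k (0 : R) :=
  ⟨List.replicate k 0, by simp, by simp [hk], by simp⟩

lemma HasBalancedFactorisation.map {R S : Type*} [Ring R] [Ring S] (f : R →+* S) {k : ℕ} {a : R}
    (h : HasBalancedFactorisation k a) : HasBalancedFactorisation k (f a) := by
  obtain ⟨l, hl, hp, hs⟩ := h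
  exact ⟨l.map f, by simp [hl], by rw [← map_list_prod, hp], by rw [← map_list_sum, hs, map_zero]⟩

lemma RingEquiv.hasBalancedFactorisation_iff {R S : Type*} [Ring R] [Ring S] (e : R ≃+* S) {k : ℕ}
    {a : S} : HasBalancedFactorisation k (e.symm a) ↔ HasBalancedFactorisation k a := by
  refine ⟨fun h ↦ ?_, fun h ↦ h.map e.symm.toRingHom⟩
  simpa using h.map e.toRingHom

lemma RingEquiv.forall_hasBalancedFactorisation_iff {R S : Type*} [Ring R] [Ring S] (e : R ≃+* S)
    {k : ℕ} : (∀ a : S, HasBalancedFactorisation k a) ↔ ∀ a : R, HasBalancedFactorisation k a := by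
  simp_rw [← e.hasBalancedFactorisation_iff]
  exact e.symm.surjective.forall.symm

lemma forall_hasBalancedFactorisation_add_two {R : Type*} [Ring R] {k : ℕ}
    (h : ∀ a : R, HasBalancedFactorisation k a) (a : R) : HasBalancedFactorisation (k + 2) a := by
  obtain ⟨l, hl, hp, hs⟩ := h (-a)
  exact ⟨1 :: -1 :: l, by simp [hl], by simp [hp], by simp [hs]⟩

lemma forall_hasBalancedFactorisation_of_le {R : Type*} [Ring R] {m k : ℕ}
    (h : ∀ a : R, HasBalancedFactorisation m a) (hmk : m ≤ k) (hpar : k % 2 = m % 2) (a : R) :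
    HasBalancedFactorisation k a := by
  obtain ⟨j, rfl⟩ : ∃ j, k = m + 2 * j := ⟨(k - m) / 2, by omega⟩
  clear hmk hpar
  induction j generalizing a with
  | zero => exact h a
  | succ j ih => exact forall_hasBalancedFactorisation_add_two ih a

lemma forall_hasBalancedFactorisation_of_two {R : Type*} [Ring R] {m n k : ℕ}
    (hm : ∀ a : R, HasBalancedFactorisation m a) (hn : ∀ a : R, HasBalancedFactorisation n a)
    (hk : (m ≤ k ∧ k % 2 = m % 2) ∨ (n ≤ k ∧ k % 2 = n % 2)) (a : R) :
    HasBalancedFactorisation k a := by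
  rcases hk with ⟨h1, h2⟩ | ⟨h1, h2⟩
  · exact forall_hasBalancedFactorisation_of_le hm h1 h2 a
  · exact forall_hasBalancedFactorisation_of_le hn h1 h2 a

variable {F : Type*} [Field F]

lemma hasBalancedFactorisation_one_iff {a : F} : HasBalancedFactorisation 1 a ↔ a = 0 := by
  refine ⟨?_, ?_⟩
  · rintro ⟨l, hl, hp, hs⟩
    obtain ⟨x, rfl⟩ := List.length_eq_one_iff.mp hl
    simp at hp hs
    rw [← hp, hs]
  · rintro rfl
    exact .zero one_ne_zero

lemma hasBalancedFactorisation_two_iff {a : F} :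
    HasBalancedFactorisation 2 a ↔ ∃ x : F, -x ^ 2 = a := by
  refine ⟨?_, ?_⟩
  · rintro ⟨l, hl, hp, hs⟩
    obtain ⟨x, y, rfl⟩ := List.length_eq_two.mp hl
    simp at hp hs
    exact ⟨x, by linear_combination hp - x * hs⟩
  · rintro ⟨x, rfl⟩
    exact ⟨[x, -x], by simp, by simp [sq], by simp⟩

lemma hasBalancedFactorisation_three_iff {a : F} :
    HasBalancedFactorisation 3 a ↔ ∃ x y : F, -(x * y * (x + y)) = a := by
  refine ⟨?_, ?_⟩
  · rintro ⟨l, hl, hp, hs⟩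
    obtain ⟨x, y, z, rfl⟩ := List.length_eq_three.mp hl
    simp at hp hs
    exact ⟨x, y, by linear_combination hp - x * y * hs⟩
  · rintro ⟨x, y, rfl⟩
    refine ⟨[x, y, -(x + y)], by simp, by simp; ring, by simp⟩

lemma hasBalancedFactorisation_four_iff {a : F} :
    HasBalancedFactorisation 4 a ↔ ∃ x y z : F, -(x * y * z * (x + y + z)) = a := by
  refine ⟨?_, ?_⟩
  · rintro ⟨l, hl, hp, hs⟩
    obtain ⟨x, l, rfl⟩ := List.exists_cons_of_length_eq_add_one hl
    obtain ⟨y, z, w, rfl⟩ := List.length_eq_three.mp (Nat.succ_injective hl)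
    simp at hp hs
    exact ⟨x, y, z, by linear_combination hp - x * y * z * hs⟩
  · rintro ⟨x, y, z, rfl⟩
    exact ⟨[x, y, z, -(x + y + z)], by simp, by simp; ring, by simp [add_assoc]⟩

variable [Fintype F]

lemma hasBalancedFactorisation_two_of_char_two (hF : ringChar F = 2) (a : F) :
    HasBalancedFactorisation 2 a := by
  obtain ⟨x, hx⟩ := FiniteField.isSquare_of_char_two hF (-a)
  exact hasBalancedFactorisation_two_iff.mpr ⟨x, by linear_combination hx⟩

lemma not_forall_hasBalancedFactorisation_two (hF : ringChar F ≠ 2) :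
    ¬ ∀ a : F, HasBalancedFactorisation 2 a := by
  intro h
  obtain ⟨a, ha⟩ := FiniteField.exists_nonsquare hF
  obtain ⟨x, hx⟩ := hasBalancedFactorisation_two_iff.mp (h (-a))
  exact ha ⟨x, by linear_combination hx⟩

lemma hasBalancedFactorisation_three (hq : 2 < Fintype.card F) (h4 : Fintype.card F ≠ 4)
    (h7 : Fintype.card F ≠ 7) (a : F) : HasBalancedFactorisation 3 a := by
  by_cases ha : a = 0
  · exact ha ▸ .zero (by norm_num)
  have : ∃ x y : F, x * y * (x + y) = -a := by
    by_cases h3 : 3 ∣ Fintype.card F - 1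
    · exact exists_mul_mul_add_eq_of_dvd (by omega) h3 (neg_ne_zero.mpr ha)
    · exact exists_mul_mul_add_eq_of_not_dvd hq h3 (neg_ne_zero.mpr ha)
  obtain ⟨x, y, h⟩ := this
  exact hasBalancedFactorisation_three_iff.mpr ⟨x, y, by rw [h, neg_neg]⟩

lemma hasBalancedFactorisation_four (hF : ringChar F ≠ 2) (hq : 7 ≤ Fintype.card F) (a : F) :
    HasBalancedFactorisation 4 a := by
  classical
  by_cases ha : IsSquare a
  · obtain ⟨c, rfl⟩ := ha
    exact ⟨[c, -c, 1, -1], by simp, by simp, by simp⟩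
  obtain ⟨r, w, hr, hw, h⟩ := exists_isSquare_two_mul_mul_sq_add hF hq ha
  have h2 : (2 : F) ≠ 0 := Ring.two_ne_zero hF
  -- The list `s, s, -a / (r * s), -r / s` has product `a`; its sum vanishes when `2 * r * s ^ 2 = r
  -- ^ 2 + a`, solved by `s = w / (2 * r)`.
  refine ⟨[w / (2 * r), w / (2 * r), -(a / (r * (w / (2 * r)))), -(r / (w / (2 * r)))],
    by simp, ?_, ?_⟩
  · simp
    field_simp
  · simp
    field_simp
    linear_combination -2 * h

/-- Over the field of four elements nonzero elements are cube roots of unity. -/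
lemma pow_three_eq_one_of_card_eq_four (hq : Fintype.card F = 4) {x : F} (hx : x ≠ 0) :
    x ^ 3 = 1 := by
  simpa [hq] using FiniteField.pow_card_sub_one_eq_one x hx

lemma exists_sq_add_self_add_one_eq_zero (hq : Fintype.card F = 4) : ∃ w : F, w ^ 2 + w + 1 = 0 := by
  classical
  obtain ⟨w, hw⟩ : ∃ t, t ∉ ({0, 1} : Finset F) := by
    by_contra! h
    have := Finset.card_le_card (fun x _ ↦ h x : (Finset.univ : Finset F) ⊆ {0, 1})
    have h2 := Finset.card_le_two (a := (0 : F)) (b := 1)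
    rw [Finset.card_univ] at this
    omega
  simp only [Finset.mem_insert, Finset.mem_singleton, not_or] at hw
  refine ⟨w, (mul_eq_zero.mp ?_).resolve_left (sub_ne_zero.mpr hw.2)⟩
  linear_combination pow_three_eq_one_of_card_eq_four hq hw.1

lemma charP_two_of_card_eq_four (hq : Fintype.card F = 4) : (2 : F) = 0 := by
  have : ((4 : ℕ) : F) = 0 := hq ▸ FiniteField.cast_card_eq_zero F
  push_cast at this
  refine pow_eq_zero_iff two_ne_zero |>.mp (?_ : (2 : F) ^ 2 = 0)
  linear_combination this

lemma hasBalancedFactorisation_five_of_card_eq_four (hq : Fintype.card F = 4) (a : F) :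
    HasBalancedFactorisation 5 a := by
  by_cases ha : a = 0
  · exact ha ▸ .zero (by norm_num)
  obtain ⟨w, hw⟩ := exists_sq_add_self_add_one_eq_zero hq
  have h2 := charP_two_of_card_eq_four hq
  have ha3 := pow_three_eq_one_of_card_eq_four hq ha
  -- `1, 1, 1, w, w ^ 2` is balanced with product 1; scaling by `a ^ 2` multiplies the product by `a
  -- ^ 10 = a`.
  refine ⟨[a ^ 2, a ^ 2, a ^ 2, a ^ 2 * w, a ^ 2 * w ^ 2], by simp, ?_, ?_⟩
  · have hw3 : w ^ 3 = 1 := by linear_combination (w - 1) * hw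
    simp
    linear_combination a ^ 10 * hw3 + a * (a ^ 6 + a ^ 3 + 1) * ha3
  · simp
    linear_combination a ^ 2 * h2 + a ^ 2 * hw

lemma not_forall_hasBalancedFactorisation_three_of_card_eq_four (hq : Fintype.card F = 4) :
    ¬ ∀ a : F, HasBalancedFactorisation 3 a := by
  intro h
  obtain ⟨w, hw⟩ := exists_sq_add_self_add_one_eq_zero hq
  have h2 := charP_two_of_card_eq_four hq
  have hw0 : w ≠ 0 := by
    rintro rfl
    simp at hw
  obtain ⟨x, y, hxy⟩ := hasBalancedFactorisation_three_iff.mp (h w)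
  have hne : x * y * (x + y) ≠ 0 := by
    intro h0
    rw [h0, neg_zero] at hxy
    exact hw0 hxy.symm
  have hx := pow_three_eq_one_of_card_eq_four hq (left_ne_zero_of_mul (left_ne_zero_of_mul hne))
  have hy := pow_three_eq_one_of_card_eq_four hq (right_ne_zero_of_mul (left_ne_zero_of_mul hne))
  have hs := pow_three_eq_one_of_card_eq_four hq (right_ne_zero_of_mul hne)
  -- `(x + y) ^ 3 = x ^ 3 + y ^ 3 + 3 * x * y * (x + y)`
  have hw1 : 1 = w := by linear_combination hs - hx - hy + 3 * hxy + w * h2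
  rw [← hw1] at hw
  have : (1 : F) = 0 := by linear_combination hw - h2
  exact one_ne_zero this

lemma hasBalancedFactorisation_iff_even_of_card_eq_two (hq : Fintype.card F = 2) {k : ℕ}
    (hk : 2 ≤ k) : (∀ a : F, HasBalancedFactorisation k a) ↔ Even k := by
  have h01 (x : F) (hx : x ≠ 0) : x = 1 := by
    simpa [hq] using FiniteField.pow_card_sub_one_eq_one x hx
  have h2 : ((2 : ℕ) : F) = 0 := hq ▸ FiniteField.cast_card_eq_zero F
  have hchar : CharP F 2 := CharTwo.of_one_ne_zero_of_two_eq_zero one_ne_zero (by exact_mod_cast h2)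
  refine ⟨fun h ↦ ?_, fun h a ↦ ?_⟩
  · obtain ⟨l, hl, hp, hs⟩ := h 1
    have hall : ∀ x ∈ l, x = 1 := fun x hx ↦ h01 x fun h0 ↦ by
      rw [List.prod_eq_zero (h0 ▸ hx)] at hp
      exact zero_ne_one hp
    rw [List.eq_replicate_of_mem hall, List.sum_replicate, hl, nsmul_one] at hs
    exact even_iff_two_dvd.mpr ((CharP.cast_eq_zero_iff F 2 k).mp hs)
  · by_cases ha : a = 0
    · exact ha ▸ .zero (by omega)
    refine ⟨List.replicate k 1, by simp, by simp [h01 a ha], ?_⟩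
    rw [List.sum_replicate, nsmul_one]
    exact (CharP.cast_eq_zero_iff F 2 k).mpr h.two_dvd

end Balanced

/-! ### Small prime fields: explicit witnesses and exhaustive checks -/

section ZMod

lemma forall_hasBalancedFactorisation_six_zmod_three (a : ZMod 3) :
    HasBalancedFactorisation 6 a := by
  fin_cases a
  · exact .zero (by norm_num)
  · exact ⟨[1, 1, 1, 1, 1, 1], rfl, rfl, rfl⟩
  · exact ⟨[1, 1, 1, 2, 2, 2], rfl, rfl, rfl⟩

lemma forall_hasBalancedFactorisation_six_zmod_five (a : ZMod 5) :
    HasBalancedFactorisation 6 a := by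
  fin_cases a
  · exact .zero (by norm_num)
  · exact ⟨[1, 1, 2, 2, 2, 2], rfl, rfl, rfl⟩
  · exact ⟨[1, 1, 1, 2, 2, 3], rfl, rfl, rfl⟩
  · exact ⟨[1, 1, 1, 1, 2, 4], rfl, rfl, rfl⟩
  · exact ⟨[1, 1, 1, 1, 3, 3], rfl, rfl, rfl⟩

lemma forall_hasBalancedFactorisation_five_zmod_seven (a : ZMod 7) :
    HasBalancedFactorisation 5 a := by
  fin_cases a
  · exact .zero (by norm_num)
  · exact ⟨[1, 1, 2, 5, 5], rfl, rfl, rfl⟩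
  · exact ⟨[1, 1, 1, 5, 6], rfl, rfl, rfl⟩
  · exact ⟨[1, 1, 1, 1, 3], rfl, rfl, rfl⟩
  · exact ⟨[1, 1, 1, 2, 2], rfl, rfl, rfl⟩
  · exact ⟨[1, 1, 3, 3, 6], rfl, rfl, rfl⟩
  · exact ⟨[1, 1, 2, 4, 6], rfl, rfl, rfl⟩

instance fact_prime_five : Fact (Nat.Prime 5) := ⟨by norm_num⟩

instance fact_prime_seven : Fact (Nat.Prime 7) := ⟨by norm_num⟩

lemma not_hasBalancedFactorisation_four_zmod_three :
    ¬ HasBalancedFactorisation 4 (2 : ZMod 3) := by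
  rw [hasBalancedFactorisation_four_iff]
  decide

lemma not_hasBalancedFactorisation_four_zmod_five :
    ¬ HasBalancedFactorisation 4 (3 : ZMod 5) := by
  rw [hasBalancedFactorisation_four_iff]
  decide

lemma not_hasBalancedFactorisation_two_zmod_seven :
    ¬ HasBalancedFactorisation 2 (4 : ZMod 7) := by
  rw [hasBalancedFactorisation_two_iff]
  decide

lemma not_hasBalancedFactorisation_three_zmod_seven :
    ¬ HasBalancedFactorisation 3 (4 : ZMod 7) := by
  rw [hasBalancedFactorisation_three_iff]
  decide

end ZMod

/-! ### Classification by cardinality -/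

section Classification

variable {F : Type*} [Field F] [Fintype F]

lemma FiniteField.exists_card_eq_two_pow_iff :
    (∃ n : ℕ, Fintype.card F = 2 ^ n) ↔ ringChar F = 2 := by
  refine ⟨fun ⟨n, hn⟩ ↦ ?_, fun h ↦ ?_⟩
  · rw [FiniteField.even_card_iff_char_two, ← Nat.even_iff, hn, Nat.even_pow]
    refine ⟨even_two, ?_⟩
    rintro rfl
    have := Fintype.one_lt_card (α := F)
    omega
  · obtain ⟨n, -, hn⟩ := FiniteField.card F (ringChar F)
    exact ⟨n, by rw [hn, h]⟩

lemma forall_hasBalancedFactorisation_iff_of_card_eq_four (hq : Fintype.card F = 4) {k : ℕ}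
    (hk : 2 ≤ k) : (∀ a : F, HasBalancedFactorisation k a) ↔ k ≠ 3 := by
  refine ⟨?_, fun h ↦ ?_⟩
  · rintro h rfl
    exact not_forall_hasBalancedFactorisation_three_of_card_eq_four hq h
  · have hF : ringChar F = 2 := FiniteField.exists_card_eq_two_pow_iff.mp ⟨2, hq⟩
    exact forall_hasBalancedFactorisation_of_two (hasBalancedFactorisation_two_of_char_two hF)
      (hasBalancedFactorisation_five_of_card_eq_four hq) (by omega)

lemma forall_hasBalancedFactorisation_iff_of_card_eq_three_or_five
    (hq : Fintype.card F = 3 ∨ Fintype.card F = 5) {k : ℕ}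
    (hk : 2 ≤ k) : (∀ a : F, HasBalancedFactorisation k a) ↔ k ≠ 2 ∧ k ≠ 4 := by
  have hF : ringChar F ≠ 2 := by
    rw [Ne, FiniteField.even_card_iff_char_two]
    omega
  have h46 : (¬ ∀ a : F, HasBalancedFactorisation 4 a) ∧
      ∀ a : F, HasBalancedFactorisation 6 a := by
    rcases hq with hq | hq
    · let e := ZMod.ringEquivOfPrime F Nat.prime_three hq
      simp_rw [e.forall_hasBalancedFactorisation_iff]
      exact ⟨fun h ↦ not_hasBalancedFactorisation_four_zmod_three (h _),
        forall_hasBalancedFactorisation_six_zmod_three⟩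
    · let e := ZMod.ringEquivOfPrime F Nat.prime_five hq
      simp_rw [e.forall_hasBalancedFactorisation_iff]
      exact ⟨fun h ↦ not_hasBalancedFactorisation_four_zmod_five (h _),
        forall_hasBalancedFactorisation_six_zmod_five⟩
  refine ⟨fun h ↦ ⟨?_, ?_⟩, fun ⟨h2, h4⟩ ↦ ?_⟩
  · rintro rfl
    exact not_forall_hasBalancedFactorisation_two hF h
  · rintro rfl
    exact h46.1 h
  · exact forall_hasBalancedFactorisation_of_two
      (hasBalancedFactorisation_three (by omega) (by omega) (by omega)) h46.2 (by omega)

lemma exists_not_hasBalancedFactorisation_of_card_eq_seven (hq : Fintype.card F = 7) :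
    ∃ a : F, ∀ k : ℕ, 1 ≤ k → k ≤ 3 → ¬ HasBalancedFactorisation k a := by
  let e := (ZMod.ringEquivOfPrime F fact_prime_seven.out hq).symm
  -- Modulo 7, three factors miss only `3` and `4`, and `3 = -2 ^ 2` has two factors, so `4` is the
  -- only possible choice.
  refine ⟨e.symm 4, fun k h1 h3 ↦ ?_⟩
  rw [e.hasBalancedFactorisation_iff]
  interval_cases k
  · rw [hasBalancedFactorisation_one_iff]
    decide
  · exact not_hasBalancedFactorisation_two_zmod_seven
  · exact not_hasBalancedFactorisation_three_zmod_seven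

lemma forall_hasBalancedFactorisation_iff_of_card_eq_seven (hq : Fintype.card F = 7) {k : ℕ}
    (hk : 2 ≤ k) : (∀ a : F, HasBalancedFactorisation k a) ↔ k ≠ 2 ∧ k ≠ 3 := by
  have hF : ringChar F ≠ 2 := by
    rw [Ne, FiniteField.even_card_iff_char_two]
    omega
  obtain ⟨a, ha⟩ := exists_not_hasBalancedFactorisation_of_card_eq_seven hq
  refine ⟨fun h ↦ ⟨?_, ?_⟩, fun ⟨h2, h3⟩ ↦ ?_⟩
  · rintro rfl
    exact ha 2 (by norm_num) (by norm_num) (h a)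
  · rintro rfl
    exact ha 3 (by norm_num) (by norm_num) (h a)
  · have h5 : ∀ a : F, HasBalancedFactorisation 5 a := by
      rw [(ZMod.ringEquivOfPrime F fact_prime_seven.out hq).forall_hasBalancedFactorisation_iff]
      exact forall_hasBalancedFactorisation_five_zmod_seven
    exact forall_hasBalancedFactorisation_of_two
      (hasBalancedFactorisation_four hF (by omega)) h5 (by omega)

lemma forall_hasBalancedFactorisation_of_char_two (hF : ringChar F = 2)
    (h2 : Fintype.card F ≠ 2) (h4 : Fintype.card F ≠ 4) {k : ℕ} (hk : 2 ≤ k) (a : F) :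
    HasBalancedFactorisation k a := by
  have h1 := Fintype.one_lt_card (α := F)
  have heven := FiniteField.even_card_iff_char_two.mp hF
  exact forall_hasBalancedFactorisation_of_two (hasBalancedFactorisation_two_of_char_two hF)
    (hasBalancedFactorisation_three (by omega) h4 (by omega)) (by omega) a

lemma forall_hasBalancedFactorisation_iff_of_char_ne_two (hF : ringChar F ≠ 2)
    (hq : 7 < Fintype.card F) {k : ℕ} (hk : 2 ≤ k) :
    (∀ a : F, HasBalancedFactorisation k a) ↔ k ≠ 2 := by
  refine ⟨?_, fun h ↦ ?_⟩
  · rintro h rfl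
    exact not_forall_hasBalancedFactorisation_two hF h
  · exact forall_hasBalancedFactorisation_of_two
      (hasBalancedFactorisation_three (by omega) (by omega) (by omega))
      (hasBalancedFactorisation_four hF hq.le) (by omega)

end Classification

theorem theorem2 {F : Type*} [Field F] [Finite F] :
    (∀ k : ℕ, 2 ≤ k →
      ((∀ a : F, HasBalancedFactorisation k a) ↔
        ((Nat.card F = 2 ∧ Even k) ∨
         (Nat.card F = 4 ∧ k ≠ 3) ∨
         ((∃ n : ℕ, Nat.card F = 2 ^ n) ∧ Nat.card F ≠ 2 ∧ Nat.card F ≠ 4) ∨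
         ((Nat.card F = 3 ∨ Nat.card F = 5) ∧ k ≠ 2 ∧ k ≠ 4) ∨
         (Nat.card F = 7 ∧ k ≠ 2 ∧ k ≠ 3) ∨
         ((¬ ∃ n : ℕ, Nat.card F = 2 ^ n) ∧ Nat.card F ≠ 3 ∧ Nat.card F ≠ 5 ∧
            Nat.card F ≠ 7 ∧ k ≠ 2)))) ∧
    ((∃ a : F, ∀ k : ℕ, 1 ≤ k → k ≤ 3 → ¬ HasBalancedFactorisation k a) ↔
      Nat.card F = 7) := by

  classical
  have := Fintype.ofFinite F
  simp only [Nat.card_eq_fintype_card, FiniteField.exists_card_eq_two_pow_iff]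
  have h1 := Fintype.one_lt_card (α := F)
  have hchar := FiniteField.even_card_iff_char_two (F := F)
  refine ⟨fun k hk ↦ ?_, ?_, exists_not_hasBalancedFactorisation_of_card_eq_seven⟩
  · by_cases h2 : Fintype.card F = 2
    · rw [hasBalancedFactorisation_iff_even_of_card_eq_two h2 hk]
      simp [h2, hchar]
    by_cases h4 : Fintype.card F = 4
    · rw [forall_hasBalancedFactorisation_iff_of_card_eq_four h4 hk]
      simp [h4, hchar]
    by_cases h35 : Fintype.card F = 3 ∨ Fintype.card F = 5
    · rw [forall_hasBalancedFactorisation_iff_of_card_eq_three_or_five h35 hk]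
      rcases h35 with h | h <;> simp [h, hchar]
    by_cases h7 : Fintype.card F = 7
    · rw [forall_hasBalancedFactorisation_iff_of_card_eq_seven h7 hk]
      simp [h7, hchar]
    by_cases hF : ringChar F = 2
    · have := forall_hasBalancedFactorisation_of_char_two hF h2 h4 hk
      tauto
    · rw [forall_hasBalancedFactorisation_iff_of_char_ne_two hF (by omega) hk]
      tauto
  · rintro ⟨a, ha⟩
    by_contra h7
    by_cases hF : ringChar F = 2
    · exact ha 2 (by norm_num) (by norm_num) (hasBalancedFactorisation_two_of_char_two hF a)
    -- Here `hchar` makes `q` odd, which excludes 2 and 4.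
    · exact ha 3 (by norm_num) le_rfl
        (hasBalancedFactorisation_three (by omega) (by omega) h7 a)
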